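/- Let $B_4=\langle\sigma_1,\sigma_2,\sigma_3\mid \sigma_1\sigma_2\sigma_1=\sigma_2\sigma_1\sigma_2,\ \sigma_2\sigma_3\sigma_2=\sigma_3\sigma_2\sigma_3,\ \sigma_1\sigma_3=\sigma_3\sigma_1\rangle$ be the braid group on four strands, $\Xi\colon B_4\to S_4$, $\sigma_i\mapsto(i\;\,i{+}1)$, the permutation of the strands, and $P_4=\ker\Xi$. Identify the free group $F_2=\langle a,b\rangle$ with the normal subgroup of $B_4$ generated by $a=\sigma_1\sigma_3^{-1}$ and $b=\sigma_2\sigma_1\sigma_3^{-1}\sigma_2^{-1}$. Let $\mathrm{SAut}(F_2)\le\mathrm{Aut}(F_2)$ be the subgroup of automorphisms acting with determinant $1$ on $H_1(F_2;\mathbb Z)\cong\mathbb Z^2$. Conjugation in $B_4$ induces a homomorphism $\rho\colon B_4\to\mathrm{SAut}(F_2)$, trivial on the centre $Z(B_4)$; let $K_4=\rho(P_4)$ be the image of $P_4$. Let $V_4\trianglelefteq S_4$ be the normal Klein four-group, and for a homomorphism $\pi\colon F_2\to Q$ put $\Gamma^+(Q,\pi)=\{f\in\mathrm{SAut}(F_2)\mid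 \pi\circ f=\pi\}$. **Proposition.** The restriction of $\Xi$ to $F_2$ is an epimorphism $\xi\colon F_2\cong\mathrm{Inn}(F_2)\to V_4$ whose kernel consists of the elements with both exponent sums even; that is, $\xi$ is the mod-2 abelianization of $F_2$. Its kernel is characteristic in $F_2$, so that $\Gamma^+(V_4,\xi)$ is a principal congruence subgroup; it is a normal subgroup of finite index in $\mathrm{SAut}(F_2)$, and $$\Gamma^+(V_4,\xi)=\langle K_4,a,b\rangle,$$ where $a,b\in F_2$ act on $F_2$ by conjugation. Moreover, there is a unique homomorphism $\xi\colon\mathrm{SAut}(F_2)\to S_4$ with $\xi\circ\rho=\Xi$; it is surjective, has kernel $K_4$, and restricts to the above $\xi$ on $\mathrm{Inn}(F_2)$. The conjugation action of $S_4$ on $V_4$ induces an isomorphism $S_3\cong S_4/V_4\cong\mathrm{Aut}(V_4)$, and the composite $$\mathrm{SAut}(F_2)\xrightarrow{\ \xi\ }S_4\longrightarrow S_3\cong\mathrm{Aut}(V_4)$$ is the action on $V_4$ induced, through $\xi\colon F_2\to V_4$, by the action of $\mathrm{SAut}(F_2)$ on $F_2$. The kernel of this composite is $\Gamma^+(V_4,\xi)$.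 -/

import Mathlib

namespace BraidF2

open Equiv

/-! ### Congruence subgroups -/

/-- The standard congruence subgroup `Γ(Q, π) = {f ∈ Aut(F) | π ∘ f = π}` of a homomorphism
`π : F → Q`. -/
def congruenceSubgroup {F Q : Type*} [Group F] [Group Q] (π : F →* Q) : Subgroup (MulAut F) where
  carrier := {f | ∀ x, π (f x) = π x}
  one_mem' := fun _ => rfl
  mul_mem' := by
    intro f g hf hg x
    exact (hf (g x)).trans (hg x)
  inv_mem' := by
    intro f hf x
    have h := hf (f⁻¹ x)
    rw [MulAut.apply_inv_self] at h
    exact h.symm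

/-! ### The free group of rank two and its special automorphisms -/

/-- The free group `F₂` of rank two. -/
abbrev F2 : Type := FreeGroup (Fin 2)

/-- The first element of the basis of `F₂`. -/
def a : F2 := FreeGroup.of 0

/-- The second element of the basis of `F₂`. -/
def b : F2 := FreeGroup.of 1

/-- The abelianization map `F₂ → ℤ²`, recording the two exponent sums. -/
def ab : F2 →* Multiplicative (Fin 2 → ℤ) :=
  FreeGroup.lift fun j => Multiplicative.ofAdd (Pi.single j 1)

/-- The exponent sum of the `i`-th basis element in `x`. -/
def expSum (x : F2) (i : Fin 2) : ℤ := Multiplicative.toAdd (ab x) i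

@[simp] theorem expSum_one : expSum 1 = 0 := by
  ext i; simp [expSum]

@[simp] theorem expSum_mul (x y : F2) : expSum (x * y) = expSum x + expSum y := by
  ext i; simp [expSum]

@[simp] theorem expSum_inv (x : F2) : expSum x⁻¹ = -expSum x := by
  ext i; simp [expSum]

@[simp] theorem expSum_of (j : Fin 2) : expSum (FreeGroup.of j) = Pi.single j 1 := by
  ext i; simp [expSum, ab]

/-- The matrix of the endomorphism of `ℤ²` induced by an endomorphism of `F₂`: its `j`-th column
is the image in `ℤ²` of the image of the `j`-th basis element. -/
def abMatrix (f : F2 →* F2) : Matrix (Fin 2) (Fin 2) ℤ :=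
  Matrix.of fun i j => expSum (f (FreeGroup.of j)) i

theorem expSum_apply (f : F2 →* F2) (x : F2) :
    expSum (f x) = (abMatrix f).mulVec (expSum x) := by
  induction x using FreeGroup.induction_on with
  | C1 => simp
  | of j => ext i; simp [abMatrix]
  | inv_of j h => rw [map_inv, expSum_inv, h, expSum_inv, Matrix.mulVec_neg]
  | mul x y hx hy => rw [map_mul, expSum_mul, hx, hy, expSum_mul, Matrix.mulVec_add]

/-- The action of `Aut(F₂)` on `H₁(F₂; ℤ) = ℤ²`, in matrix form. -/
def homologyRep : MulAut F2 →* Matrix (Fin 2) (Fin 2) ℤ where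
  toFun f := abMatrix f.toMonoidHom
  map_one' := by
    ext i j
    simp [abMatrix, Matrix.one_apply, Pi.single_apply]
  map_mul' f g := by
    ext i j
    have h := congrFun (expSum_apply f.toMonoidHom (g (FreeGroup.of j))) i
    simpa [abMatrix, Matrix.mul_apply, Matrix.mulVec, dotProduct] using h

/-- The group `SAut(F₂)` of special automorphisms: those that act on `H₁(F₂; ℤ) = ℤ²` with
determinant `1`. -/
def SAut : Subgroup (MulAut F2) := (Matrix.detMonoidHom.comp homologyRep).ker

theorem mem_SAut (f : MulAut F2) : f ∈ SAut ↔
    expSum (f a) 0 * expSum (f b) 1 - expSum (f b) 0 * expSum (f a) 1 = 1 := by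
  rw [SAut, MonoidHom.mem_ker]
  simp [homologyRep, abMatrix, Matrix.det_fin_two, a, b]

/-- The homomorphism `F₂ → Inn(F₂) ≤ SAut(F₂)`, where `x` acts by `y ↦ x y x⁻¹`. -/
def inn : F2 →* SAut :=
  (MulAut.conj : F2 →* MulAut F2).codRestrict SAut fun x => by
    rw [mem_SAut]
    simp [a, b]

/-- The congruence subgroup `Γ⁺(Q, π) = Γ(Q, π) ∩ SAut(F₂)`, as a subgroup
of `SAut(F₂)`. -/
def congruenceSubgroupPlus {Q : Type*} [Group Q] (π : F2 →* Q) : Subgroup SAut :=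
  (congruenceSubgroup π).subgroupOf SAut

/-! ### The braid group on four strands -/

/-- The relators of the Artin presentation of `B₄`; the generators `0, 1, 2` stand for
`σ₁, σ₂, σ₃`. -/
def braidRels : Set (FreeGroup (Fin 3)) :=
  let s : Fin 3 → FreeGroup (Fin 3) := FreeGroup.of
  {s 0 * s 1 * s 0 * (s 1 * s 0 * s 1)⁻¹,
   s 1 * s 2 * s 1 * (s 2 * s 1 * s 2)⁻¹,
   s 0 * s 2 * (s 2 * s 0)⁻¹}

/-- The braid group `B₄`. -/
abbrev B4 : Type := PresentedGroup braidRels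

/-- The Artin generators of `B₄`: `σ 0, σ 1, σ 2` are `σ₁, σ₂, σ₃`. -/
def σ (i : Fin 3) : B4 := PresentedGroup.of i

theorem σ_rel₀₁ : σ 0 * σ 1 * σ 0 = σ 1 * σ 0 * σ 1 := by
  have h : (PresentedGroup.mk braidRels) _ = 1 :=
    PresentedGroup.one_of_mem (rels := braidRels) (Or.inl rfl)
  exact mul_inv_eq_one.mp h

theorem σ_rel₁₂ : σ 1 * σ 2 * σ 1 = σ 2 * σ 1 * σ 2 := by
  have h : (PresentedGroup.mk braidRels) _ = 1 :=
    PresentedGroup.one_of_mem (rels := braidRels) (Or.inr (Or.inl rfl))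
  exact mul_inv_eq_one.mp h

theorem σ_rel₀₂ : σ 0 * σ 2 = σ 2 * σ 0 := by
  have h : (PresentedGroup.mk braidRels) _ = 1 :=
    PresentedGroup.one_of_mem (rels := braidRels) (Or.inr (Or.inr rfl))
  exact mul_inv_eq_one.mp h

/-- The homomorphism from `B₄` given by three elements satisfying the braid relations. -/
def B4.lift {G : Type*} [Group G] (s : Fin 3 → G) (h₀₁ : s 0 * s 1 * s 0 = s 1 * s 0 * s 1)
    (h₁₂ : s 1 * s 2 * s 1 = s 2 * s 1 * s 2) (h₀₂ : s 0 * s 2 = s 2 * s 0) : B4 →* G :=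
  PresentedGroup.toGroup (f := s) (by
    rintro r (rfl | rfl | rfl)
    · simp only [map_mul, map_inv, FreeGroup.lift_apply_of, mul_inv_eq_one]; exact h₀₁
    · simp only [map_mul, map_inv, FreeGroup.lift_apply_of, mul_inv_eq_one]; exact h₁₂
    · simp only [map_mul, map_inv, FreeGroup.lift_apply_of, mul_inv_eq_one]; exact h₀₂)

@[simp] theorem B4.lift_σ {G : Type*} [Group G] (s : Fin 3 → G) (h₀₁ h₁₂ h₀₂) (i : Fin 3) :
    B4.lift s h₀₁ h₁₂ h₀₂ (σ i) = s i :=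
  PresentedGroup.toGroup.of _

/-- The epimorphism `Ξ : B₄ → S₄` recording the permutation of the strands. -/
def strandPerm : B4 →* Perm (Fin 4) :=
  B4.lift ![swap 0 1, swap 1 2, swap 2 3] (by decide) (by decide) (by decide)

/-- The pure braid group `P₄`. -/
def P4 : Subgroup B4 := strandPerm.ker

/-- The homomorphism `F₂ → B₄` with `a ↦ σ₁ σ₃⁻¹` and `b ↦ σ₂ σ₁ σ₃⁻¹ σ₂⁻¹`. It is injective
(`braidOfF2_injective` below), so it identifies `F₂` with a subgroup of `B₄`. -/
def braidOfF2 : F2 →* B4 :=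
  FreeGroup.lift ![σ 0 * (σ 2)⁻¹, σ 1 * σ 0 * (σ 2)⁻¹ * (σ 1)⁻¹]

/-- The automorphism of `F₂` with the given values on the basis; `v` gives its inverse. -/
def mkAut (u v : Fin 2 → F2) (huv : ∀ j, FreeGroup.lift v (u j) = FreeGroup.of j)
    (hvu : ∀ j, FreeGroup.lift u (v j) = FreeGroup.of j) : MulAut F2 :=
  MonoidHom.toMulEquiv (FreeGroup.lift u) (FreeGroup.lift v)
    (FreeGroup.ext_hom _ _ fun j => by simpa using huv j)
    (FreeGroup.ext_hom _ _ fun j => by simpa using hvu j)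

@[simp] theorem mkAut_of (u v : Fin 2 → F2) {huv hvu} (j : Fin 2) :
    mkAut u v huv hvu (FreeGroup.of j) = u j := by
  simp [mkAut]

/-- The conjugation actions of `σ₁, σ₂, σ₃` on `F₂ ≤ B₄`:
`σ₁ : a ↦ a, b ↦ b a⁻¹`; `σ₂ : a ↦ b, b ↦ b a⁻¹ b`; `σ₃ : a ↦ a, b ↦ a⁻¹ b`. -/
def σAut : Fin 3 → MulAut F2 :=
  ![mkAut ![a, b * a⁻¹] ![a, b * a]
      (by intro j; fin_cases j <;> simp [a, b]) (by intro j; fin_cases j <;> simp [a, b]),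
    mkAut ![b, b * a⁻¹ * b] ![a * b⁻¹ * a, a]
      (by intro j; fin_cases j <;> simp [a, b, mul_assoc])
      (by intro j; fin_cases j <;> simp [a, b, mul_assoc]),
    mkAut ![a, a⁻¹ * b] ![a, a * b]
      (by intro j; fin_cases j <;> simp [a, b]) (by intro j; fin_cases j <;> simp [a, b])]

theorem mulAut_ext {f g : MulAut F2} (ha : f a = g a) (hb : f b = g b) : f = g := by
  have h : f.toMonoidHom = g.toMonoidHom :=
    FreeGroup.ext_hom _ _ fun j => by fin_cases j <;> assumption
  exact MulEquiv.ext fun x => DFunLike.congr_fun h x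

@[simp] theorem σAut_zero_a : σAut 0 a = a := by simp [σAut, a, b]
@[simp] theorem σAut_zero_b : σAut 0 b = b * a⁻¹ := by simp [σAut, a, b]
@[simp] theorem σAut_one_a : σAut 1 a = b := by simp [σAut, a, b]
@[simp] theorem σAut_one_b : σAut 1 b = b * a⁻¹ * b := by simp [σAut, a, b]
@[simp] theorem σAut_two_a : σAut 2 a = a := by simp [σAut, a, b]
@[simp] theorem σAut_two_b : σAut 2 b = a⁻¹ * b := by simp [σAut, a, b]

/-- The homomorphism `B₄ → Aut(F₂)` given by the conjugation action of `B₄` on its normal subgroup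
`F₂`; see `braidOfF2_braidAct`. -/
def braidAct : B4 →* MulAut F2 :=
  B4.lift σAut
    (mulAut_ext (by simp [mul_assoc]) (by simp [mul_assoc]))
    (mulAut_ext (by simp [mul_assoc]) (by simp [mul_assoc]))
    (mulAut_ext (by simp) (by simp [mul_assoc]))

@[simp] theorem strandPerm_σ (i : Fin 3) :
    strandPerm (σ i) = (![swap 0 1, swap 1 2, swap 2 3] : Fin 3 → Perm (Fin 4)) i :=
  B4.lift_σ _ _ _ _ i

@[simp] theorem braidAct_σ (i : Fin 3) : braidAct (σ i) = σAut i := B4.lift_σ _ _ _ _ i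

@[simp] theorem braidOfF2_a : braidOfF2 a = σ 0 * (σ 2)⁻¹ := by simp [braidOfF2, a]

@[simp] theorem braidOfF2_b : braidOfF2 b = σ 1 * σ 0 * (σ 2)⁻¹ * (σ 1)⁻¹ := by
  simp [braidOfF2, b]

theorem B4.induction {p : B4 → Prop} (h : ∀ i, p (σ i)) (one : p 1)
    (mul : ∀ g g', p g → p g' → p (g * g')) (inv : ∀ g, p g → p g⁻¹) (g : B4) : p g := by
  have hg : g ∈ Subgroup.closure (Set.range (PresentedGroup.of (rels := braidRels))) := by
    rw [PresentedGroup.closure_range_of]; trivial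
  induction hg using Subgroup.closure_induction with
  | mem x hx => obtain ⟨i, rfl⟩ := hx; exact h i
  | one => exact one
  | mul x y _ _ hx hy => exact mul x y hx hy
  | inv x _ hx => exact inv x hx

theorem braid_conj {G : Type*} [Group G] {x y z : G} (h₁ : x * y * x = y * x * y)
    (h₂ : y * z * y = z * y * z) (h₃ : x * z = z * x) :
    x * z⁻¹ = x * (x * z⁻¹) * x⁻¹ ∧
    (y * x * z⁻¹ * y⁻¹) * (x * z⁻¹)⁻¹ = x * (y * x * z⁻¹ * y⁻¹) * x⁻¹ ∧
    (y * x * z⁻¹ * y⁻¹) * (x * z⁻¹)⁻¹ * (y * x * z⁻¹ * y⁻¹) =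
      y * (y * x * z⁻¹ * y⁻¹) * y⁻¹ ∧
    x * z⁻¹ = z * (x * z⁻¹) * z⁻¹ ∧
    (x * z⁻¹)⁻¹ * (y * x * z⁻¹ * y⁻¹) = z * (y * x * z⁻¹ * y⁻¹) * z⁻¹ := by
  have c : Commute x z := h₃
  have e₁ : y * z⁻¹ * y⁻¹ = z⁻¹ * y⁻¹ * z := by
    rw [mul_inv_eq_iff_eq_mul, mul_assoc, mul_assoc, eq_inv_mul_iff_mul_eq, eq_inv_mul_iff_mul_eq,
      ← mul_assoc, ← mul_assoc, mul_inv_eq_iff_eq_mul, h₂]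
  have e₂ : y * x * y⁻¹ = x⁻¹ * y * x := by
    rw [mul_inv_eq_iff_eq_mul, mul_assoc, mul_assoc, eq_inv_mul_iff_mul_eq, ← mul_assoc,
      ← mul_assoc, h₁]
  have e₃ : z⁻¹ * y⁻¹ * z⁻¹ = y⁻¹ * z⁻¹ * y⁻¹ := by
    have := congrArg (·⁻¹) h₂
    simpa [mul_assoc] using this.symm
  have e₄ : y⁻¹ * x⁻¹ * y = x * y⁻¹ * x⁻¹ := by
    rw [eq_mul_inv_iff_mul_eq, mul_assoc, mul_assoc, inv_mul_eq_iff_eq_mul, inv_mul_eq_iff_eq_mul,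
      ← mul_assoc, ← mul_assoc, eq_mul_inv_iff_mul_eq, h₁]
  have c' : x * z⁻¹ = z⁻¹ * x := c.inv_right.eq
  have p₂ : (y * x * z⁻¹ * y⁻¹) * (x * z⁻¹)⁻¹ = x * (y * x * z⁻¹ * y⁻¹) * x⁻¹ := by
    calc _ = y * x * (z⁻¹ * y⁻¹ * z) * x⁻¹ := by group
      _ = (y * x * y) * z⁻¹ * y⁻¹ * x⁻¹ := by rw [← e₁]; group
      _ = _ := by rw [← h₁]; group
  refine ⟨?_, p₂, ?_, ?_, ?_⟩
  · rw [eq_mul_inv_iff_mul_eq, mul_assoc, ← c']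
  · rw [p₂]
    calc _ = (x * y * x) * z⁻¹ * (y⁻¹ * x⁻¹ * y) * x * z⁻¹ * y⁻¹ := by group
      _ = y * x * y * (z⁻¹ * x) * y⁻¹ * z⁻¹ * y⁻¹ := by rw [e₄, h₁]; group
      _ = y * (x * y * x) * z⁻¹ * (y⁻¹ * z⁻¹ * y⁻¹) := by rw [← c']; group
      _ = y * y * x * (y * z⁻¹ * y⁻¹) * (y * z⁻¹ * y⁻¹) * z⁻¹ := by rw [← e₃, h₁]; group
      _ = _ := by rw [e₁]; group
  · rw [← mul_assoc, ← h₃, mul_inv_cancel_right]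
  · calc _ = z * (x⁻¹ * y * x) * z⁻¹ * y⁻¹ := by group
      _ = z * y * x * (y⁻¹ * z⁻¹ * y⁻¹) := by rw [← e₂]; group
      _ = _ := by rw [← e₃]; group

/-- Under the identification of `F₂` with a subgroup of `B₄`, the action `braidAct` is the
conjugation action `x ↦ g x g⁻¹`. -/
theorem braidOfF2_braidAct (g : B4) (x : F2) :
    braidOfF2 (braidAct g x) = g * braidOfF2 x * g⁻¹ := by
  have key : ∀ (f : MulAut F2) (h : B4), braidOfF2 (f a) = h * braidOfF2 a * h⁻¹ →
      braidOfF2 (f b) = h * braidOfF2 b * h⁻¹ →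
      ∀ y, braidOfF2 (f y) = h * braidOfF2 y * h⁻¹ := by
    intro f h ha hb y
    have e : braidOfF2.comp f.toMonoidHom = (MulAut.conj h).toMonoidHom.comp braidOfF2 :=
      FreeGroup.ext_hom _ _ fun j => by fin_cases j <;> assumption
    exact DFunLike.congr_fun e y
  induction g using B4.induction generalizing x with
  | one => simp
  | mul g g' hg hg' => rw [map_mul, MulAut.mul_apply, hg, hg']; group
  | inv g hg =>
    have h := hg ((braidAct g)⁻¹ x)
    rw [MulAut.apply_inv_self] at h
    rw [map_inv, h]; group
  | h i =>
    rw [braidAct_σ]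
    revert x
    have h := braid_conj σ_rel₀₁ σ_rel₁₂ σ_rel₀₂
    fin_cases i
    · exact key _ _ (by simpa using h.1) (by simpa [mul_assoc] using h.2.1)
    · exact key _ _ (by simp [mul_assoc]) (by simpa [mul_assoc] using h.2.2.1)
    · exact key _ _ (by simpa using h.2.2.2.1) (by simpa [mul_assoc] using h.2.2.2.2)

theorem braidAct_braidOfF2 (x : F2) : braidAct (braidOfF2 x) = MulAut.conj x := by
  have e : braidAct.comp braidOfF2 = MulAut.conj :=
    FreeGroup.ext_hom _ _ fun j => by
      fin_cases j
      · change braidAct (braidOfF2 a) = MulAut.conj a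
        rw [braidOfF2_a, map_mul, map_inv, mul_inv_eq_iff_eq_mul, braidAct_σ, braidAct_σ]
        exact mulAut_ext (by simp) (by simp)
      · change braidAct (braidOfF2 b) = MulAut.conj b
        have hc : σAut 1 * (σAut 0 * (σAut 2)⁻¹) * (σAut 1)⁻¹ = MulAut.conj b := by
          have h0 : σAut 0 * (σAut 2)⁻¹ = MulAut.conj a :=
            mul_inv_eq_iff_eq_mul.mpr (mulAut_ext (by simp) (by simp))
          rw [h0, mul_inv_eq_iff_eq_mul]
          refine MulEquiv.ext fun y => ?_
          simp
        simpa [mul_assoc] using hc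
  exact DFunLike.congr_fun e x

/-- `F₂` embeds in `B₄`. The proof maps `B₄` to the holomorph `F₂ ⋊ Aut(F₂)`. -/
theorem braidOfF2_injective : Function.Injective braidOfF2 := by
  let s : Fin 3 → F2 ⋊[MonoidHom.id (MulAut F2)] MulAut F2 :=
    ![⟨1, σAut 0⟩, ⟨1, σAut 1⟩, ⟨a⁻¹, σAut 0⟩]
  have hs : σAut 0 * σAut 1 * σAut 0 = σAut 1 * σAut 0 * σAut 1 :=
    mulAut_ext (by simp [mul_assoc]) (by simp [mul_assoc])
  let r := B4.lift s (SemidirectProduct.ext (by simp [s]) (by simpa [s] using hs))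
    (SemidirectProduct.ext (by simp [s, mul_assoc]) (by simpa [s] using hs.symm))
    (SemidirectProduct.ext (by simp [s]) (by simp [s]))
  have e : r.comp braidOfF2 = SemidirectProduct.inl :=
    FreeGroup.ext_hom _ _ fun j => by
      fin_cases j
      · change r (braidOfF2 a) = SemidirectProduct.inl a
        rw [braidOfF2_a, map_mul, map_inv, mul_inv_eq_iff_eq_mul, B4.lift_σ, B4.lift_σ]
        exact SemidirectProduct.ext (by simp [s]) (by simp [s])
      · change r (braidOfF2 b) = SemidirectProduct.inl b
        have ha : SemidirectProduct.inl a = s 0 * (s 2)⁻¹ :=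
          eq_mul_inv_iff_mul_eq.mpr (SemidirectProduct.ext (by simp [s]) (by simp [s]))
        have hb : r (braidOfF2 b) = s 1 * (s 0 * (s 2)⁻¹) * (s 1)⁻¹ := by
          simp [r, mul_assoc]
        rw [hb, ← ha, mul_inv_eq_iff_eq_mul]
        exact SemidirectProduct.ext (by simp [s]) (by simp [s])
  intro x y hxy
  apply SemidirectProduct.inl_injective (φ := MonoidHom.id (MulAut F2))
  rw [← e, MonoidHom.comp_apply, MonoidHom.comp_apply, hxy]

/-- The homomorphism `B₄ → SAut(F₂)` given by the conjugation action. -/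
def braidToSAut : B4 →* SAut :=
  braidAct.codRestrict SAut fun g => by
    induction g using B4.induction with
    | one => rw [map_one]; exact one_mem _
    | mul g g' hg hg' => rw [map_mul]; exact mul_mem hg hg'
    | inv g hg => rw [map_inv]; exact inv_mem hg
    | h i =>
      rw [braidAct_σ, mem_SAut]
      fin_cases i <;> simp <;> simp [a, b]

/-- The centre of `B₄` acts trivially, so `braidToSAut` descends to `B₄ / Z(B₄) → SAut(F₂)`. -/
theorem center_le_ker : Subgroup.center B4 ≤ braidToSAut.ker := by
  intro z hz
  rw [MonoidHom.mem_ker]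
  refine Subtype.ext (MulEquiv.ext fun x => braidOfF2_injective ?_)
  change braidOfF2 (braidAct z x) = braidOfF2 x
  rw [braidOfF2_braidAct, ← Subgroup.mem_center_iff.mp hz, mul_inv_cancel_right]

/-- The subgroup `K₄` of `SAut(F₂)`: the image of `P₄`, equivalently of `P₄ / Z(P₄)`, under the map
`B₄ / Z(B₄) → SAut(F₂)`. -/
def K4 : Subgroup SAut := P4.map braidToSAut

/-! ### The Klein subgroup of `S₄` -/

/-- The normal Klein subgroup `V₄ = {1, (12)(34), (13)(24), (14)(23)}` of `S₄`. -/
def V4 : Subgroup (Perm (Fin 4)) where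
  carrier := {g | g = 1 ∨ g = swap 0 1 * swap 2 3 ∨ g = swap 0 2 * swap 1 3 ∨
    g = swap 0 3 * swap 1 2}
  one_mem' := Or.inl rfl
  mul_mem' := by
    rintro g h (rfl | rfl | rfl | rfl) (rfl | rfl | rfl | rfl) <;>
      simp only [Set.mem_ofPred_eq] <;> decide
  inv_mem' := by
    rintro g (rfl | rfl | rfl | rfl) <;> simp only [Set.mem_ofPred_eq] <;> decide

theorem mem_V4 (g : Perm (Fin 4)) : g ∈ V4 ↔ g = 1 ∨ g = swap 0 1 * swap 2 3 ∨
    g = swap 0 2 * swap 1 3 ∨ g = swap 0 3 * swap 1 2 := Iff.rfl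

instance : V4.Normal where
  conj_mem := by
    simp only [mem_V4]
    decide

/-- The homomorphism `S₃ = S₄ / V₄ → Aut(V₄)` induced by the conjugation action of `S₄` on `V₄`,
which descends to the quotient because `V₄` is abelian. -/
def quotientToAutV4 : Perm (Fin 4) ⧸ V4 →* MulAut V4 :=
  QuotientGroup.lift V4 MulAut.conjNormal fun g hg => MulEquiv.ext fun v => Subtype.ext (by
    rw [MulAut.conjNormal_apply, MulAut.one_apply]
    obtain ⟨v, hv⟩ := v
    rw [mem_V4] at hg hv
    change g * v * g⁻¹ = v
    clear * - hg hv
    revert g v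
    decide)

/-- The homomorphism `ξ : F₂ ≅ Inn(F₂) → V₄`, the restriction of `Ξ : B₄ → S₄` to `F₂ ≤ B₄`. -/
def xiF2 : F2 →* V4 :=
  (strandPerm.comp braidOfF2).codRestrict V4 fun x => by
    induction x using FreeGroup.induction_on with
    | C1 => rw [map_one]; exact one_mem _
    | of j =>
      fin_cases j
      · change strandPerm (braidOfF2 a) ∈ V4
        rw [braidOfF2_a, mem_V4]
        simp
      · change strandPerm (braidOfF2 b) ∈ V4
        rw [braidOfF2_b, mem_V4]
        simp only [map_mul, map_inv, strandPerm_σ]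
        decide
    | inv_of j h => rw [map_inv]; exact inv_mem h
    | mul x y hx hy => rw [map_mul]; exact mul_mem hx hy

end BraidF2

open BraidF2

/-!
The statement reduces to two facts about the conjugation action `ρ : B₄ → SAut(F₂)`: it is onto
(`braidToSAut_surjective`), and its kernel acts trivially on the strands (`ker_braidToSAut_le`).
Together they provide a unique `ξ : SAut(F₂) → S₄` with `ξ ∘ ρ = Ξ`, and since the action of a braid
on `F₂ ≤ B₄` is conjugation, the remaining claims become finite computations in `S₄`.

Surjectivity is Nielsen's theorem in rank two. In the coset `f ρ(B₄)` one chooses the automorphism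
`h` for which `|h(a)| + |h(b)|` is least. The image of `ρ` contains the elementary Nielsen moves and
the inner automorphisms, and this makes `h` Nielsen reduced
(`FreeGroup.IsMinimalPair.isNielsenReduced`). The usual tie-breaking order on half-words is not
needed: when two halves of one generator are cancelled by the other generator, conjugation by such a
half-word, after a Nielsen move, shortens the pair. A Nielsen reduced homomorphism does not decrease
lengths (`FreeGroup.norm_le_of_isNielsenReduced`), so `h⁻¹` sends basis elements to letters and is a
power of the quarter turn `a ↦ b, b ↦ a⁻¹`. All estimates use only that the free group with the
distance `|x⁻¹ y|` satisfies the four-point condition of a tree (`FreeGroup.norm_four_point`).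

For the kernel, let `c = a⁻¹ b a b⁻¹`, which is fixed by `σ₁` and `σ₂` and sent to a conjugate by
`σ₃`. Hence each braid `g` sends `c` to `x c x⁻¹` for some `x ∈ F₂`, and `g` and `x` move the last
strand to the same place (`exists_braidAct_boundaryWord`). If `g` acts trivially, then `x` centralizes
`c`, which forces `ξ(x) = 1` (`xiF2_eq_one_of_commute`), so `g` fixes the last strand. As `Ξ(g)` also
centralizes `V₄`, it is trivial.
-/

namespace FreeGroup

/-! ### The tree metric on a free group -/

section TreeMetric

/-- The length of the longest common prefix of two lists. -/
def commonPrefixLength {β : Type*} [DecidableEq β] : List β → List β → ℕ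
  | x :: xs, y :: ys => if x = y then commonPrefixLength xs ys + 1 else 0
  | [], _ => 0
  | _ :: _, [] => 0

theorem min_commonPrefixLength_le {β : Type*} [DecidableEq β] (l₁ l₂ l₃ : List β) :
    min (commonPrefixLength l₁ l₂) (commonPrefixLength l₂ l₃) ≤ commonPrefixLength l₁ l₃ := by
  induction l₁ generalizing l₂ l₃ with
  | nil => simp [commonPrefixLength]
  | cons x xs ih =>
    rcases l₂ with _ | ⟨y, ys⟩
    · simp [commonPrefixLength]
    rcases l₃ with _ | ⟨z, zs⟩
    · simp [commonPrefixLength]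
    simp only [commonPrefixLength]
    have := ih ys zs
    split_ifs <;> simp_all

variable {α : Type*} [DecidableEq α]

theorem length_reduce_invRev_append {L₁ L₂ : List (α × Bool)} (h₁ : IsReduced L₁)
    (h₂ : IsReduced L₂) :
    (reduce (invRev L₁ ++ L₂)).length + 2 * commonPrefixLength L₁ L₂ =
      L₁.length + L₂.length := by
  induction L₁ generalizing L₂ with
  | nil => simp [commonPrefixLength, h₂.reduce_eq]
  | cons p L₁ ih =>
    rcases L₂ with _ | ⟨q, L₂⟩
    · simp [commonPrefixLength, reduce_invRev, h₁.reduce_eq]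
    have h₁' : IsReduced L₁ := h₁.infix ⟨[p], [], by simp⟩
    have h₂' : IsReduced L₂ := h₂.infix ⟨[q], [], by simp⟩
    by_cases hpq : p = q
    · subst hpq
      have e : reduce (invRev (p :: L₁) ++ p :: L₂) = reduce (invRev L₁ ++ L₂) := by
        apply reduce.sound
        have e₁ : (mk (p :: L₁) : FreeGroup α) = mk [p] * mk L₁ := by simp [mul_mk]
        have e₂ : (mk (p :: L₂) : FreeGroup α) = mk [p] * mk L₂ := by simp [mul_mk]
        rw [← mul_mk, ← mul_mk, ← inv_mk, ← inv_mk, e₁, e₂]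
        group
      have := ih h₁' h₂'
      simp only [e, commonPrefixLength, if_true, List.length_cons]
      omega
    · have hr : IsReduced (invRev (p :: L₁) ++ q :: L₂) := by
        have h₁i : IsReduced (invRev (p :: L₁)) := by
          rw [isReduced_iff_reduce_eq, reduce_invRev, h₁.reduce_eq]
        refine List.isChain_append.mpr ⟨h₁i, h₂, ?_⟩
        rw [invRev_cons]
        rcases p with ⟨p, s⟩
        rcases q with ⟨q, t⟩
        simp only [invRev, List.map_cons, List.map_nil, List.reverse_singleton,
          List.getLast?_concat, List.head?_cons, Option.mem_def, Option.some.injEq]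
        rintro _ rfl _ rfl rfl
        cases s <;> cases t <;> simp_all
      simp only [hr.reduce_eq, commonPrefixLength, hpq, if_false, List.length_append,
        invRev_length]
      omega

theorem norm_inv_mul_add (x y : FreeGroup α) :
    norm (x⁻¹ * y) + 2 * commonPrefixLength x.toWord y.toWord = norm x + norm y := by
  have := length_reduce_invRev_append (isReduced_toWord (x := x)) (isReduced_toWord (x := y))
  rwa [← toWord_inv, ← toWord_mul] at this

theorem even_norm_add (x y : FreeGroup α) : Even (norm x + norm y + norm (x * y)) := by
  have := norm_inv_mul_add x⁻¹ y
  rw [inv_inv, norm_inv_eq] at this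
  exact ⟨norm (x * y) + commonPrefixLength x⁻¹.toWord y.toWord, by omega⟩

theorem norm_four_point_one (x y z : FreeGroup α) :
    norm (x⁻¹ * z) + norm y ≤ max (norm (x⁻¹ * y) + norm z) (norm (y⁻¹ * z) + norm x) := by
  have := norm_inv_mul_add x y
  have := norm_inv_mul_add y z
  have := norm_inv_mul_add x z
  have := min_commonPrefixLength_le x.toWord y.toWord z.toWord
  omega

theorem norm_inv_mul_comm (x y : FreeGroup α) : norm (x⁻¹ * y) = norm (y⁻¹ * x) := by
  rw [← norm_inv_eq]; simp

/-- The four-point condition: the distance `d(x, y) = |x⁻¹ y|` makes the free group a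
`0`-hyperbolic space, being the metric of the Cayley tree. -/
theorem norm_four_point (w x y z : FreeGroup α) :
    norm (w⁻¹ * y) + norm (x⁻¹ * z) ≤
      max (norm (w⁻¹ * x) + norm (y⁻¹ * z)) (norm (w⁻¹ * z) + norm (x⁻¹ * y)) := by
  have := norm_four_point_one (x⁻¹ * w) (x⁻¹ * z) (x⁻¹ * y)
  simp only [mul_inv_rev, inv_inv, mul_assoc, mul_inv_cancel_left] at this
  rw [norm_inv_mul_comm z y, norm_inv_mul_comm x w] at this
  omega

/-- Every element of even length has a midpoint on the geodesic from `1`. -/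
theorem exists_midpoint (x : FreeGroup α) (k : ℕ) (hx : norm x = k + k) :
    ∃ p : FreeGroup α, norm p = k ∧ norm (p⁻¹ * x) = k := by
  have hl : x.toWord.length = k + k := hx
  refine ⟨mk (x.toWord.take k), ?_, ?_⟩
  · have hr : IsReduced (x.toWord.take k) :=
      isReduced_toWord.infix (List.take_prefix k _).isInfix
    rw [norm, toWord_mk, hr.reduce_eq, List.length_take, hl]
    omega
  · have hr : IsReduced (x.toWord.drop k) :=
      isReduced_toWord.infix (List.drop_suffix k _).isInfix
    have e : (mk (x.toWord.take k))⁻¹ * x = mk (x.toWord.drop k) := by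
      rw [inv_mul_eq_iff_eq_mul, mul_mk, List.take_append_drop, mk_toWord]
    rw [e, norm, toWord_mk, hr.reduce_eq, List.length_drop, hl]
    omega

theorem norm_lt_norm_mul_self {x : FreeGroup α} (hx : x ≠ 1) : norm x < norm (x * x) := by
  have h₁ := congrArg List.length (reduceCyclically.reduce_flatten_replicate_succ
    (isReduced_toWord (x := x)) 1)
  have h₂ := congrArg List.length (reduceCyclically.conj_conjugator_reduceCyclically x.toWord)
  have h₃ : norm (x * x) = (reduce (List.replicate (1 + 1) x.toWord).flatten).length := by
    simp [norm, toWord_mul, List.replicate]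
  have h₄ : reduceCyclically x.toWord ≠ [] := by
    intro h
    have := reduceCyclically.conj_conjugator_reduceCyclically x.toWord
    rw [h, List.append_nil] at this
    apply hx
    rw [← mk_toWord (x := x), ← this, ← mul_mk, ← inv_mk, mul_inv_cancel]
  have := List.length_pos_iff.mpr h₄
  simp only [List.length_append, invRev_length, List.length_flatten, List.map_replicate,
    List.sum_replicate, smul_eq_mul] at h₁ h₂
  rw [h₃, h₁, norm, ← h₂]
  omega

end TreeMetric

/-! ### Nielsen reduced homomorphisms -/

section NielsenReduced

variable {α β : Type*} [DecidableEq β]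

/-- A homomorphism of free groups is Nielsen reduced if the images of the letters `x ∈ α ∪ α⁻¹`
form a Nielsen reduced set: they are nontrivial, at most half of each factor cancels in a product
of two of them, and no factor cancels entirely in a product of three of them. Here a letter is
encoded as `mk [ℓ]`, and only products along reduced words are considered. -/
structure IsNielsenReduced (f : FreeGroup α →* FreeGroup β) : Prop where
  pos : ∀ ℓ, 0 < norm (f (mk [ℓ]))
  left_le : ∀ ℓ m, (ℓ.1 = m.1 → ℓ.2 = m.2) → norm (f (mk [ℓ])) ≤ norm (f (mk [ℓ]) * f (mk [m]))
  right_le : ∀ ℓ m, (ℓ.1 = m.1 → ℓ.2 = m.2) → norm (f (mk [m])) ≤ norm (f (mk [ℓ]) * f (mk [m]))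
  triple : ∀ ℓ m n, (ℓ.1 = m.1 → ℓ.2 = m.2) → (m.1 = n.1 → m.2 = n.2) →
    norm (f (mk [ℓ])) + norm (f (mk [n])) <
      norm (f (mk [ℓ]) * f (mk [m])) + norm (f (mk [m]) * f (mk [n]))

/-- The induction behind Nielsen's length estimate: the cancellation between a letter and a reduced
word is the cancellation with the first letter of the word alone. Indeed the images of the prefixes
of the word are points of a tree, and by the four-point condition a path in a tree never backtracks
further than it does between consecutive segments, provided that no segment is cancelled entirely by
its two neighbours. -/
theorem length_le_norm_aux {f : FreeGroup α →* FreeGroup β} (hf : IsNielsenReduced f)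
    (L : List (α × Bool)) (ℓ : α × Bool) (hL : IsReduced (ℓ :: L)) :
    L.length + 1 ≤ norm (f (mk (ℓ :: L))) ∧
    ∀ m : α × Bool, (m.1 = ℓ.1 → m.2 = ℓ.2) →
      norm (f (mk [m]) * f (mk (ℓ :: L))) + norm (f (mk [ℓ])) =
        norm (f (mk (ℓ :: L))) + norm (f (mk [m]) * f (mk [ℓ])) ∧
      2 * (L.length + 1) + norm (f (mk [m])) ≤
        norm (f (mk (ℓ :: L))) + norm (f (mk [m]) * f (mk (ℓ :: L))) := by
  induction L generalizing ℓ with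
  | nil =>
    refine ⟨hf.pos ℓ, fun m hm => ⟨by omega, ?_⟩⟩
    have h₁ := hf.left_le m ℓ hm
    have h₂ := hf.pos ℓ
    obtain ⟨r, hr⟩ := even_norm_add (f (mk [m])) (f (mk [ℓ]))
    simp only [List.length_nil]
    omega
  | cons n L ih =>
    have hn : ℓ.1 = n.1 → ℓ.2 = n.2 := (List.isChain_cons_cons.mp hL).1
    obtain ⟨ih₁, ih₂⟩ := ih n (List.isChain_cons_cons.mp hL).2
    obtain ⟨ih₂, ih₃⟩ := ih₂ ℓ hn
    have e : f (mk (ℓ :: n :: L)) = f (mk [ℓ]) * f (mk (n :: L)) := by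
      rw [← _root_.map_mul, mul_mk]; rfl
    have h₁ := hf.left_le ℓ n hn
    have h₂ := hf.right_le ℓ n hn
    have h₃ := hf.pos ℓ
    obtain ⟨r, hr⟩ := even_norm_add (f (mk [ℓ])) (f (mk [n]))
    rw [e]
    simp only [List.length_cons]
    refine ⟨by omega, fun m hm => ?_⟩
    have h₄ := hf.triple m ℓ n hm hn
    obtain ⟨r', hr'⟩ := even_norm_add (f (mk [m])) (f (mk [ℓ]))
    -- the four points are `y⁻¹`, `1`, `x` and `x v`
    generalize f (mk [m]) = y at *
    generalize f (mk [ℓ]) = x at *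
    generalize f (mk [n]) = z at *
    generalize f (mk (n :: L)) = v at *
    have q₁ := norm_four_point y⁻¹ 1 x (x * v)
    have q₂ := norm_four_point y⁻¹ x (x * v) 1
    simp only [inv_inv, inv_one, one_mul, mul_one, inv_mul_cancel_left, mul_inv_rev,
      norm_inv_eq] at q₁ q₂
    have q₃ : norm (v⁻¹ * x⁻¹) = norm (x * v) := by rw [← mul_inv_rev, norm_inv_eq]
    rw [q₃] at q₂
    omega

/-- A Nielsen reduced homomorphism does not decrease lengths. -/
theorem norm_le_of_isNielsenReduced [DecidableEq α] {f : FreeGroup α →* FreeGroup β}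
    (hf : IsNielsenReduced f) (w : FreeGroup α) : norm w ≤ norm (f w) := by
  rcases h : w.toWord with _ | ⟨ℓ, L⟩
  · simp [norm, h]
  · have hr : IsReduced (ℓ :: L) := h ▸ isReduced_toWord
    have := (length_le_norm_aux hf L ℓ hr).1
    rw [← h, mk_toWord] at this
    rw [norm, h]
    exact this

end NielsenReduced


/-! ### Minimal pairs -/

section MinimalPair

variable {α : Type*} [DecidableEq α]

/-- A set `B` of pairs of elements that is stable under the elementary Nielsen moves and under
simultaneous conjugation. -/
structure IsNielsenStable (B : FreeGroup α → FreeGroup α → Prop) : Prop where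
  swap : ∀ {x y}, B x y → B y x
  inv_right : ∀ {x y}, B x y → B x y⁻¹
  mul_left : ∀ {x y}, B x y → B x (x * y)
  conj : ∀ {x y} (p : FreeGroup α), B x y → B (p⁻¹ * x * p) (p⁻¹ * y * p)

/-- The pair `(x, y)` belongs to `B` and has the least total length among the pairs in `B`. -/
def IsMinimalPair (B : FreeGroup α → FreeGroup α → Prop) (x y : FreeGroup α) : Prop :=
  B x y ∧ ∀ x' y', B x' y' → norm x + norm y ≤ norm x' + norm y'

variable {B : FreeGroup α → FreeGroup α → Prop} {x y : FreeGroup α}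

theorem IsMinimalPair.swap (hB : IsNielsenStable B) (h : IsMinimalPair B x y) :
    IsMinimalPair B y x :=
  ⟨hB.swap h.1, fun x' y' h' => by have := h.2 x' y' h'; omega⟩

theorem IsMinimalPair.inv_right (hB : IsNielsenStable B) (h : IsMinimalPair B x y) :
    IsMinimalPair B x y⁻¹ :=
  ⟨hB.inv_right h.1, fun x' y' h' => by rw [norm_inv_eq]; exact h.2 x' y' h'⟩

theorem IsMinimalPair.inv_left (hB : IsNielsenStable B) (h : IsMinimalPair B x y) :
    IsMinimalPair B x⁻¹ y :=
  ((h.swap hB).inv_right hB).swap hB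

theorem IsMinimalPair.norm_right_le (hB : IsNielsenStable B) (h : IsMinimalPair B x y) :
    norm y ≤ norm (x * y) := by
  have := h.2 _ _ (hB.mul_left h.1)
  omega

theorem IsMinimalPair.norm_left_le (hB : IsNielsenStable B) (h : IsMinimalPair B x y) :
    norm x ≤ norm (x * y) := by
  have := ((h.swap hB).inv_left hB |>.inv_right hB).norm_right_le hB
  rwa [← mul_inv_rev, norm_inv_eq, norm_inv_eq] at this

/-- If `x` and `x⁻¹` each cancelled half of `y` in `x y x⁻¹`, the two halves of `y` would be inverse
to each other, contrary to `|y| < |y²|`. -/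
theorem IsMinimalPair.lt_of_conj (hB : IsNielsenStable B) (h : IsMinimalPair B x y) (hy : y ≠ 1) :
    norm x + norm x⁻¹ < norm (x * y) + norm (y * x⁻¹) := by
  have h₁ := h.norm_left_le hB
  have h₂ := (h.inv_right hB).norm_left_le hB
  have h₃ : norm (y * x⁻¹) = norm (x * y⁻¹) := by
    rw [← norm_inv_eq, mul_inv_rev, inv_inv]
  have h₄ := norm_lt_norm_mul_self hy
  have q := norm_four_point y 1 y⁻¹ x⁻¹
  simp only [inv_inv, inv_one, one_mul, mul_one, norm_inv_eq] at q
  rw [← mul_inv_rev, ← mul_inv_rev, norm_inv_eq, norm_inv_eq] at q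
  rw [norm_inv_eq]
  omega

/-- If both factors `x` cancelled half of `y = p q⁻¹` in `x y x`, then `x` would begin with `q`
and end with `p⁻¹`, and `(p⁻¹ y p, p⁻¹ (y x) p)` would be shorter than `(x, y)`. -/
theorem IsMinimalPair.lt_of_sandwich (hB : IsNielsenStable B) (h : IsMinimalPair B x y)
    (hy : y ≠ 1) : norm x + norm x < norm (x * y) + norm (y * x) := by
  have h₁ := h.norm_left_le hB
  have h₂ := (h.swap hB).norm_right_le hB
  have h₃ := h.norm_right_le hB
  have h₄ : 0 < norm y := Nat.pos_of_ne_zero (mt norm_eq_zero.mp hy)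
  by_contra hlt
  have h₅ : norm (x * y) = norm x := by omega
  have h₆ : norm (y * x) = norm x := by omega
  obtain ⟨k, hk⟩ : Even (norm y) := by
    obtain ⟨r, hr⟩ := even_norm_add x y
    exact ⟨r - norm x, by omega⟩
  obtain ⟨p, hp, hp'⟩ := exists_midpoint y k hk
  have hmin := h.2 _ _ (hB.swap (hB.conj p (hB.mul_left (h.swap hB).1)))
  have hyp : norm (p⁻¹ * y * p) ≤ norm y := by
    have := norm_mul_le (p⁻¹ * y) p
    omega
  -- the geodesics from `1` to `y x` and from `y` to `y x y` pass through the midpoints `p` and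
  -- `y x p` of their first and last segments
  have q₁ := norm_four_point 1 p y (y * x)
  have q₂ := norm_four_point y (y * x) (y * x * p) (y * x * y)
  have q₃ := norm_four_point p y (y * x * p) (y * x)
  have e : norm (p⁻¹ * y⁻¹) = norm (y * p) := by rw [← mul_inv_rev, norm_inv_eq]
  have e₂ : norm (y⁻¹ * p) = k := by rw [norm_inv_mul_comm, hp']
  simp only [inv_one, one_mul, mul_assoc, mul_inv_rev, inv_mul_cancel_left, inv_mul_cancel,
    mul_one, norm_inv_eq, inv_mul_cancel_left] at q₁ q₂ q₃ hmin hyp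
  omega

variable {f : FreeGroup (Fin 2) →* FreeGroup α}

/-- A minimal pair of generators is Nielsen reduced. -/
theorem IsMinimalPair.isNielsenReduced (hB : IsNielsenStable B) (hf : Function.Injective f)
    (h : IsMinimalPair B (f (of 0)) (f (of 1))) : IsNielsenReduced f := by
  have hinv : ∀ i s, (mk [(i, !s)] : FreeGroup (Fin 2)) = (mk [(i, s)])⁻¹ := by
    intro i s; simp [inv_mk, invRev]
  have hne : ∀ ℓ : Fin 2 × Bool, f (mk [ℓ]) ≠ 1 := by
    intro ℓ hℓ
    rw [← _root_.map_one f] at hℓ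
    have := congrArg norm (hf hℓ)
    rw [norm_one, norm, toWord_mk, reduce_singleton] at this
    simp at this
  have hmin : ∀ ℓ m : Fin 2 × Bool, ℓ.1 ≠ m.1 → IsMinimalPair B (f (mk [ℓ])) (f (mk [m])) := by
    have h₀ : ∀ s t, IsMinimalPair B (f (mk [(0, s)])) (f (mk [(1, t)])) := by
      have h₁ : IsMinimalPair B (f (mk [(0, true)])) (f (mk [(1, true)])) := h
      have h₂ : ∀ t, IsMinimalPair B (f (mk [(0, true)])) (f (mk [(1, t)])) := by
        rintro (_ | _)
        · rw [show false = !true from rfl, hinv, _root_.map_inv]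
          exact h₁.inv_right hB
        · exact h₁
      rintro (_ | _) t
      · rw [show (mk [(0, false)] : FreeGroup (Fin 2)) = _ from hinv 0 true, _root_.map_inv]
        exact (h₂ t).inv_left hB
      · exact h₂ t
    rintro ⟨i, s⟩ ⟨j, t⟩ hij
    fin_cases i <;> fin_cases j
    · exact absurd rfl hij
    · exact h₀ s t
    · exact (h₀ t s).swap hB
    · exact absurd rfl hij
  have hleft : ∀ ℓ m : Fin 2 × Bool, (ℓ.1 = m.1 → ℓ.2 = m.2) →
      norm (f (mk [ℓ])) ≤ norm (f (mk [ℓ]) * f (mk [m])) := by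
    intro ℓ m hℓ
    by_cases e : ℓ.1 = m.1
    · rw [← Prod.ext e (hℓ e)]
      exact (norm_lt_norm_mul_self (hne ℓ)).le
    · exact (hmin ℓ m e).norm_left_le hB
  have hright : ∀ ℓ m : Fin 2 × Bool, (ℓ.1 = m.1 → ℓ.2 = m.2) →
      norm (f (mk [m])) ≤ norm (f (mk [ℓ]) * f (mk [m])) := by
    intro ℓ m hℓ
    by_cases e : ℓ.1 = m.1
    · rw [← Prod.ext e (hℓ e)]
      exact (norm_lt_norm_mul_self (hne ℓ)).le
    · exact (hmin ℓ m e).norm_right_le hB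
  refine ⟨fun ℓ => Nat.pos_of_ne_zero (mt norm_eq_zero.mp (hne ℓ)), hleft, hright, ?_⟩
  intro ℓ m n hℓ hn
  have h₁ := hleft ℓ m hℓ
  have h₂ := hright m n hn
  by_cases e : ℓ.1 = m.1
  · obtain rfl := Prod.ext e (hℓ e)
    have := norm_lt_norm_mul_self (hne ℓ)
    omega
  by_cases e' : m.1 = n.1
  · obtain rfl := Prod.ext e' (hn e')
    have := norm_lt_norm_mul_self (hne m)
    omega
  obtain ⟨i, s⟩ := ℓ
  obtain ⟨k, t⟩ := n
  have hik : i = k := by simp only at e e'; omega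
  subst hik
  rcases Bool.eq_or_eq_not t s with rfl | rfl
  · exact (hmin _ m e).lt_of_sandwich hB (hne m)
  · rw [hinv, _root_.map_inv]
    exact (hmin _ m e).lt_of_conj hB (hne m)

end MinimalPair

end FreeGroup

namespace BraidF2
open Equiv

/-! ### Generation of the special automorphism group by the braid group -/

section Surjectivity

theorem coe_braidToSAut (g : B4) : (braidToSAut g : MulAut F2) = braidAct g := rfl

theorem braidToSAut_braidOfF2 (x : F2) : braidToSAut (braidOfF2 x) = inn x :=
  Subtype.ext (braidAct_braidOfF2 x)

theorem braidAct_quarterTurn_a : braidAct (σ 1 * σ 0 * σ 2) a = b := by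
  simp

theorem braidAct_quarterTurn_b : braidAct (σ 1 * σ 0 * σ 2) b = a⁻¹ := by
  simp [mul_assoc]

theorem braidAct_σ_two_inv_b : braidAct (σ 2)⁻¹ b = a * b := by
  rw [map_inv, braidAct_σ]
  exact (MulEquiv.symm_apply_eq (σAut 2)).mpr (by simp)

theorem braidAct_σ_two_inv_a : braidAct (σ 2)⁻¹ a = a := by
  rw [map_inv, braidAct_σ]
  exact (MulEquiv.symm_apply_eq (σAut 2)).mpr (by simp)

/-- The pairs that are, up to inverting the second element, images of the basis `(a, b)` under an
automorphism in the coset of `f` modulo the image of the braid group. -/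
def IsBraidTranslate (f : MulAut F2) (x y : F2) : Prop :=
  ∃ g : B4, f (braidAct g a) = x ∧ (f (braidAct g b) = y ∨ f (braidAct g b) = y⁻¹)

theorem isNielsenStable_isBraidTranslate (f : MulAut F2) :
    FreeGroup.IsNielsenStable (IsBraidTranslate f) where
  swap := by
    rintro x y ⟨g, rfl, h⟩
    rcases h with h | h
    · refine ⟨g * (σ 1 * σ 0 * σ 2), ?_, Or.inr ?_⟩
      · rw [map_mul, MulAut.mul_apply, braidAct_quarterTurn_a, h]
      · rw [map_mul, MulAut.mul_apply, braidAct_quarterTurn_b, map_inv, map_inv]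
    · refine ⟨g * (σ 1 * σ 0 * σ 2)⁻¹, ?_, Or.inl ?_⟩
      · have e : braidAct (σ 1 * σ 0 * σ 2)⁻¹ a = b⁻¹ := by
          rw [map_inv]
          refine (MulEquiv.symm_apply_eq (braidAct (σ 1 * σ 0 * σ 2))).mpr ?_
          rw [map_inv, braidAct_quarterTurn_b, inv_inv]
        rw [map_mul, MulAut.mul_apply, e, map_inv, map_inv, h, inv_inv]
      · have e : braidAct (σ 1 * σ 0 * σ 2)⁻¹ b = a := by
          rw [map_inv]
          exact (MulEquiv.symm_apply_eq (braidAct (σ 1 * σ 0 * σ 2))).mpr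
            braidAct_quarterTurn_a.symm
        rw [map_mul, MulAut.mul_apply, e]
  inv_right := by
    rintro x y ⟨g, rfl, h⟩
    exact ⟨g, rfl, by rw [inv_inv]; exact h.symm⟩
  mul_left := by
    rintro x y ⟨g, rfl, h⟩
    rcases h with h | h
    · refine ⟨g * (σ 2)⁻¹, ?_, Or.inl ?_⟩
      · rw [map_mul, MulAut.mul_apply, braidAct_σ_two_inv_a]
      · rw [map_mul, MulAut.mul_apply, braidAct_σ_two_inv_b, map_mul, map_mul, h]
    · refine ⟨g * σ 0, ?_, Or.inr ?_⟩
      · rw [map_mul, MulAut.mul_apply, braidAct_σ, σAut_zero_a]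
      · rw [map_mul, MulAut.mul_apply, braidAct_σ, σAut_zero_b, map_mul, map_mul, h, map_inv,
          map_inv, mul_inv_rev]
  conj := by
    rintro x y p ⟨g, rfl, h⟩
    have e : ∀ z, f (braidAct (braidOfF2 (f⁻¹ p⁻¹) * g) z) = p⁻¹ * f (braidAct g z) * p := by
      intro z
      have e' : f (f⁻¹ p⁻¹) = p⁻¹ := MulAut.apply_inv_self F2 f p⁻¹
      rw [map_mul, MulAut.mul_apply, braidAct_braidOfF2, MulAut.conj_apply, map_mul, map_mul,
        map_inv f, e', inv_inv]
    refine ⟨braidOfF2 (f⁻¹ p⁻¹) * g, e a, ?_⟩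
    rcases h with h | h
    · exact Or.inl (by rw [e, h])
    · exact Or.inr (by rw [e, h]; group)

theorem exists_eq_of_norm_le_one {x : F2} (hx : FreeGroup.norm x ≤ 1) (hx' : x ≠ 1) :
    x = a ∨ x = a⁻¹ ∨ x = b ∨ x = b⁻¹ := by
  have h₁ : x.toWord.length = 1 :=
    le_antisymm hx (Nat.pos_of_ne_zero (mt FreeGroup.norm_eq_zero.mp hx'))
  obtain ⟨⟨i, s⟩, h⟩ := List.length_eq_one_iff.mp h₁
  rw [← FreeGroup.mk_toWord (x := x), h]
  fin_cases i <;> cases s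
  · exact Or.inr (Or.inl rfl)
  · exact Or.inl rfl
  · exact Or.inr (Or.inr (Or.inr rfl))
  · exact Or.inr (Or.inr (Or.inl rfl))

/-- A special automorphism that sends basis elements to letters is a power of the quarter turn
`a ↦ b, b ↦ a⁻¹`. -/
theorem mem_range_of_norm_le_one {f : SAut}
    (ha : FreeGroup.norm ((f : MulAut F2) a) ≤ 1) (hb : FreeGroup.norm ((f : MulAut F2) b) ≤ 1) :
    f ∈ braidToSAut.range := by
  have hdet := (mem_SAut _).mp f.2
  have hne : ∀ i, (f : MulAut F2) (FreeGroup.of i) ≠ 1 := fun i h =>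
    FreeGroup.of_ne_one i ((map_eq_one_iff _ (f : MulAut F2).injective).mp h)
  have key : ∀ n : ℕ, braidAct ((σ 1 * σ 0 * σ 2) ^ n) a = (f : MulAut F2) a →
      braidAct ((σ 1 * σ 0 * σ 2) ^ n) b = (f : MulAut F2) b → f ∈ braidToSAut.range :=
    fun n h h' => ⟨(σ 1 * σ 0 * σ 2) ^ n, Subtype.ext (mulAut_ext h h')⟩
  have ta := braidAct_quarterTurn_a
  have tb := braidAct_quarterTurn_b
  generalize σ 1 * σ 0 * σ 2 = t at *
  rcases exists_eq_of_norm_le_one ha (hne 0) with h | h | h | h <;>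
    rcases exists_eq_of_norm_le_one hb (hne 1) with h' | h' | h' | h' <;>
    rw [h, h'] at hdet key <;> simp [a, b] at hdet
  · exact key 0 (by simp) (by simp)
  · exact key 2 (by simp [pow_succ, ta, tb]) (by simp [pow_succ, ta, tb])
  · exact key 1 (by simp [ta]) (by simp [tb])
  · exact key 3 (by simp [pow_succ, ta, tb]) (by simp [pow_succ, ta, tb])

/-- The special automorphism group is generated by the conjugation action of the braid group. -/
theorem braidToSAut_surjective : Function.Surjective braidToSAut := by
  intro f
  -- choose `g` so that the images of `a` and `b` under `f ∘ ρ(g)` have the least total length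
  let len : B4 → ℕ := fun g =>
    FreeGroup.norm ((f : MulAut F2) (braidAct g a)) + FreeGroup.norm ((f : MulAut F2) (braidAct g b))
  obtain ⟨g, hg⟩ : ∃ g, ∀ g', len g ≤ len g' :=
    ⟨Function.argmin len, fun g' => Function.argmin_le len g'⟩
  let h : SAut := f * braidToSAut g
  have hmin : FreeGroup.IsMinimalPair (IsBraidTranslate f) ((h : MulAut F2).toMonoidHom a)
      ((h : MulAut F2).toMonoidHom b) := by
    refine ⟨⟨g, rfl, Or.inl rfl⟩, ?_⟩
    rintro x y ⟨g', rfl, h' | h'⟩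
    · rw [← h']
      exact hg g'
    · rw [← FreeGroup.norm_inv_eq (x := y), ← h']
      exact hg g'
  have hred := hmin.isNielsenReduced (isNielsenStable_isBraidTranslate f) (h : MulAut F2).injective
  have hinv : ∀ w, FreeGroup.norm (((h⁻¹ : SAut) : MulAut F2) w) ≤ FreeGroup.norm w := by
    intro w
    have := FreeGroup.norm_le_of_isNielsenReduced hred (((h⁻¹ : SAut) : MulAut F2) w)
    rwa [show (h : MulAut F2).toMonoidHom (((h⁻¹ : SAut) : MulAut F2) w) = w from
      MulAut.apply_inv_self F2 (h : MulAut F2) w] at this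
  have hh : h⁻¹ ∈ braidToSAut.range :=
    mem_range_of_norm_le_one ((hinv a).trans (FreeGroup.norm_of 0).le)
      ((hinv b).trans (FreeGroup.norm_of 1).le)
  have hf : f = (h⁻¹)⁻¹ * (braidToSAut g)⁻¹ := by simp [h]
  rw [← MonoidHom.mem_range, hf]
  exact mul_mem (inv_mem hh) (inv_mem ⟨g, rfl⟩)

end Surjectivity


/-! ### The map onto the Klein group -/

section XiF2

theorem coe_xiF2 (x : F2) : (xiF2 x : Perm (Fin 4)) = strandPerm (braidOfF2 x) := rfl

theorem coe_xiF2_a : (xiF2 a : Perm (Fin 4)) = swap 0 1 * swap 2 3 := by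
  rw [coe_xiF2, braidOfF2_a]
  simp

theorem coe_xiF2_b : (xiF2 b : Perm (Fin 4)) = swap 0 2 * swap 1 3 := by
  rw [coe_xiF2, braidOfF2_b]
  simp only [map_mul, map_inv, strandPerm_σ]
  decide

theorem xiF2_surjective : Function.Surjective xiF2 := by
  rintro ⟨v, hv⟩
  rcases (mem_V4 v).mp hv with h | h | h | h
  · exact ⟨1, Subtype.ext ((congrArg _ (map_one xiF2)).trans h.symm)⟩
  · exact ⟨a, Subtype.ext (coe_xiF2_a.trans h.symm)⟩
  · exact ⟨b, Subtype.ext (coe_xiF2_b.trans h.symm)⟩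
  · refine ⟨a * b, Subtype.ext (Eq.trans ?_ h.symm)⟩
    rw [map_mul, Subgroup.coe_mul, coe_xiF2_a, coe_xiF2_b]
    decide

theorem map_eq_zpow_expSum {M : Type*} [Group M] (φ : F2 →* M) (h : Commute (φ a) (φ b)) (x : F2) :
    φ x = φ a ^ expSum x 0 * φ b ^ expSum x 1 := by
  induction x using FreeGroup.induction_on with
  | C1 => simp
  | of j => fin_cases j <;> simp [a, b]
  | inv_of j _ => fin_cases j <;> simp [a, b]
  | mul x y hx hy =>
    rw [map_mul, hx, hy, expSum_mul, Pi.add_apply, Pi.add_apply, zpow_add, zpow_add, mul_assoc,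
      mul_assoc, ← mul_assoc (φ b ^ _), ← mul_assoc (φ a ^ expSum y 0),
      (h.zpow_zpow (expSum y 0) (expSum x 1)).eq]

theorem zpow_eq_one_iff_even {M : Type*} [Group M] {g : M} (hg : g ≠ 1) (hg' : g * g = 1) (n : ℤ) :
    g ^ n = 1 ↔ Even n := by
  rw [← orderOf_dvd_iff_zpow_eq_one, orderOf_eq_prime (p := 2) (by rw [pow_two, hg']) hg,
    even_iff_two_dvd]
  rfl

theorem xiF2_eq_one_iff (x : F2) : xiF2 x = 1 ↔ ∀ i, Even (expSum x i) := by
  have hA := zpow_eq_one_iff_even (g := (swap 0 1 * swap 2 3 : Perm (Fin 4))) (by decide)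
    (by decide)
  have hB := zpow_eq_one_iff_even (g := (swap 0 2 * swap 1 3 : Perm (Fin 4))) (by decide)
    (by decide)
  have hx : (xiF2 x : Perm (Fin 4)) =
      (swap 0 1 * swap 2 3) ^ expSum x 0 * (swap 0 2 * swap 1 3) ^ expSum x 1 := by
    have := map_eq_zpow_expSum (V4.subtype.comp xiF2) (by
      change Commute (xiF2 a : Perm (Fin 4)) (xiF2 b : Perm (Fin 4))
      rw [coe_xiF2_a, coe_xiF2_b]
      change _ * _ = _ * _
      decide) x
    rwa [MonoidHom.comp_apply, MonoidHom.comp_apply, MonoidHom.comp_apply, V4.subtype_apply,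
      V4.subtype_apply, V4.subtype_apply, coe_xiF2_a, coe_xiF2_b] at this
  rw [Fin.forall_fin_two, ← OneMemClass.coe_eq_one, hx]
  constructor
  · intro h
    rcases Int.even_or_odd (expSum x 0) with h₀ | h₀
    · rw [(hA _).mpr h₀, one_mul] at h
      exact ⟨h₀, (hB _).mp h⟩
    · obtain ⟨m, hm⟩ := h₀
      rw [hm, zpow_add_one, (hA _).mpr (even_two_mul m)] at h
      rcases Int.even_or_odd (expSum x 1) with h₁ | ⟨n, hn⟩
      · rw [(hB _).mpr h₁] at h
        exact absurd h (by decide)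
      · rw [hn, zpow_add_one, (hB _).mpr (even_two_mul n)] at h
        exact absurd h (by decide)
  · rintro ⟨h₀, h₁⟩
    rw [(hA _).mpr h₀, (hB _).mpr h₁, one_mul]

theorem xiF2_ker_characteristic : xiF2.ker.Characteristic := by
  refine Subgroup.characteristic_iff_le_comap.mpr fun f x hx => ?_
  rw [MonoidHom.mem_ker, xiF2_eq_one_iff] at hx
  rw [Subgroup.mem_comap, MonoidHom.mem_ker, xiF2_eq_one_iff]
  intro i
  rw [expSum_apply, Matrix.mulVec, dotProduct, Fin.sum_univ_two]
  exact ((hx 0).mul_left _).add ((hx 1).mul_left _)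

theorem coe_xiF2_braidAct (g : B4) (x : F2) :
    (xiF2 (braidAct g x) : Perm (Fin 4)) = strandPerm g * xiF2 x * (strandPerm g)⁻¹ := by
  rw [coe_xiF2, braidOfF2_braidAct, map_mul, map_mul, map_inv, ← coe_xiF2]

end XiF2

/-! ### The kernel of the action of the braid group -/

section Kernel

/-- The commutator of the basis that is fixed by `σ₁` and `σ₂`. -/
def boundaryWord : F2 := a⁻¹ * b * a * b⁻¹

/-- The centralizer of `boundaryWord` lies in the kernel of `ξ`. Under the two maps `F₂ → S₃` that
send one basis element to a transposition and the other to a `3`-cycle, `boundaryWord` becomes a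
`3`-cycle, whose centralizer consists of even permutations; so both exponent sums are even. -/
theorem xiF2_eq_one_of_commute {x : F2} (hx : Commute x boundaryWord) : xiF2 x = 1 := by
  have key : ∀ φ : F2 →* Perm (Fin 3),
      (∀ s : Perm (Fin 3), s * φ boundaryWord = φ boundaryWord * s → Perm.sign s = 1) →
      (Perm.sign (φ a)) ^ expSum x 0 * (Perm.sign (φ b)) ^ expSum x 1 = 1 := by
    intro φ hφ
    have h := hφ (φ x) (by rw [← map_mul, hx.eq, map_mul])
    rwa [← MonoidHom.comp_apply, map_eq_zpow_expSum _ (Commute.all _ _)] at h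
  let φ : F2 →* Perm (Fin 3) := FreeGroup.lift ![swap 0 1, swap 0 1 * swap 1 2]
  let ψ : F2 →* Perm (Fin 3) := FreeGroup.lift ![swap 0 1 * swap 1 2, swap 0 1]
  have φa : φ a = swap 0 1 := FreeGroup.lift_apply_of
  have φb : φ b = swap 0 1 * swap 1 2 := FreeGroup.lift_apply_of
  have ψa : ψ a = swap 0 1 * swap 1 2 := FreeGroup.lift_apply_of
  have ψb : ψ b = swap 0 1 := FreeGroup.lift_apply_of
  have h₀ := key φ (by
    rw [boundaryWord, map_mul, map_mul, map_mul, map_inv, map_inv, φa, φb]; decide)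
  have h₁ := key ψ (by
    rw [boundaryWord, map_mul, map_mul, map_mul, map_inv, map_inv, ψa, ψb]; decide)
  have s₁ : Perm.sign (swap 0 1 : Perm (Fin 3)) = -1 := by decide
  have s₂ : Perm.sign (swap 0 1 * swap 1 2 : Perm (Fin 3)) = 1 := by decide
  rw [φa, φb, s₁, s₂, one_zpow, mul_one, zpow_eq_one_iff_even (by decide) (by decide)] at h₀
  rw [ψa, ψb, s₁, s₂, one_zpow, one_mul, zpow_eq_one_iff_even (by decide) (by decide)] at h₁
  exact (xiF2_eq_one_iff x).mpr (Fin.forall_fin_two.mpr ⟨h₀, h₁⟩)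

/-- A braid maps `boundaryWord` to a conjugate, and the conjugating element records the image of the
last strand. -/
theorem exists_braidAct_boundaryWord (g : B4) :
    ∃ x : F2, braidAct g boundaryWord = x * boundaryWord * x⁻¹ ∧
      strandPerm g 3 = (xiF2 x : Perm (Fin 4)) 3 := by
  induction g using B4.induction with
  | h i =>
    fin_cases i
    · refine ⟨1, by simp [boundaryWord, mul_assoc], ?_⟩
      rw [map_one, strandPerm_σ]
      decide
    · refine ⟨1, by simp [boundaryWord, mul_assoc], ?_⟩
      rw [map_one, strandPerm_σ]
      decide
    · refine ⟨a⁻¹, by simp [boundaryWord, mul_assoc], ?_⟩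
      rw [map_inv, Subgroup.coe_inv, coe_xiF2_a, strandPerm_σ]
      decide
  | one => exact ⟨1, by simp, by simp⟩
  | mul g g' hg hg' =>
    obtain ⟨x, hx, hx'⟩ := hg
    obtain ⟨y, hy, hy'⟩ := hg'
    refine ⟨braidAct g y * x, ?_, ?_⟩
    · rw [map_mul, MulAut.mul_apply, hy, map_mul, map_mul, map_inv, hx]
      group
    · rw [map_mul, map_mul, Subgroup.coe_mul, coe_xiF2_braidAct]
      simp [← hx', hy']
  | inv g hg =>
    obtain ⟨x, hx, hx'⟩ := hg
    refine ⟨braidAct g⁻¹ x⁻¹, ?_, ?_⟩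
    · have h : boundaryWord = x⁻¹ * braidAct g boundaryWord * x := by rw [hx]; group
      have e : ∀ y, braidAct g⁻¹ (braidAct g y) = y := fun y => by
        rw [map_inv]; exact MulAut.inv_apply_self F2 _ y
      conv_lhs => rw [h]
      rw [map_mul, map_mul, e, map_inv, inv_inv]
    · rw [coe_xiF2_braidAct, map_inv, map_inv, Subgroup.coe_inv]
      simp [hx']

theorem ker_braidToSAut_le : braidToSAut.ker ≤ strandPerm.ker := by
  intro g hg
  have hg : ∀ x, braidAct g x = x := fun x => by
    rw [← coe_braidToSAut, MonoidHom.mem_ker.mp hg]; rfl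
  obtain ⟨x, hx, hx'⟩ := exists_braidAct_boundaryWord g
  have h₃ : xiF2 x = 1 := by
    apply xiF2_eq_one_of_commute
    rw [hg, eq_mul_inv_iff_mul_eq] at hx
    exact hx.symm
  have hcomm : ∀ y, strandPerm g * xiF2 y = xiF2 y * strandPerm g := fun y => by
    have := coe_xiF2_braidAct g y
    rw [hg, eq_mul_inv_iff_mul_eq] at this
    exact this.symm
  have hA := hcomm a
  have hB := hcomm b
  rw [coe_xiF2_a] at hA
  rw [coe_xiF2_b] at hB
  rw [h₃] at hx'
  rw [MonoidHom.mem_ker]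
  clear * - hA hB hx'
  generalize strandPerm g = s at *
  revert s
  simp only [OneMemClass.coe_one, Perm.one_apply]
  decide

end Kernel

/-! ### The symmetric group modulo the Klein group -/

section SymmetricGroup

/-- The embedding of `S₃` in `S₄` as the stabilizer of the last point. -/
def permFinThree : Perm (Fin 3) →* Perm (Fin 4) :=
  (finSumFinEquiv (m := 3) (n := 1)).permCongrHom.toMonoidHom.comp
    ((Perm.sumCongrHom (Fin 3) (Fin 1)).comp (MonoidHom.inl _ _))

theorem permFinThree_bijective :
    Function.Bijective ((QuotientGroup.mk' V4).comp permFinThree) := by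
  constructor
  · rw [injective_iff_map_eq_one]
    intro s hs
    rw [MonoidHom.comp_apply, QuotientGroup.mk'_apply, QuotientGroup.eq_one_iff, mem_V4] at hs
    revert s
    decide
  · intro q
    obtain ⟨g, rfl⟩ := QuotientGroup.mk'_surjective V4 q
    have h : ∀ g : Perm (Fin 4), ∃ s : Perm (Fin 3), (permFinThree s)⁻¹ * g ∈ V4 := by
      simp only [mem_V4]
      decide
    obtain ⟨s, hs⟩ := h g
    exact ⟨s, QuotientGroup.eq.mpr hs⟩

theorem quotientToAutV4_mk (g : Perm (Fin 4)) (v : V4) :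
    (quotientToAutV4 (QuotientGroup.mk' V4 g) v : Perm (Fin 4)) = g * v * g⁻¹ :=
  MulAut.conjNormal_apply g v

theorem quotientToAutV4_bijective : Function.Bijective quotientToAutV4 := by
  constructor
  · rw [injective_iff_map_eq_one]
    intro q hq
    obtain ⟨g, rfl⟩ := QuotientGroup.mk'_surjective V4 q
    have h₁ := quotientToAutV4_mk g (xiF2 a)
    have h₂ := quotientToAutV4_mk g (xiF2 b)
    rw [hq, MulAut.one_apply, coe_xiF2_a] at h₁
    rw [hq, MulAut.one_apply, coe_xiF2_b] at h₂
    rw [QuotientGroup.mk'_apply, QuotientGroup.eq_one_iff, mem_V4]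
    clear * - h₁ h₂
    revert g
    decide
  · intro φ
    -- `φ` sends the two generators to distinct nontrivial elements, and `S₄` acts transitively on
    -- the pairs of such elements
    have hne : ∀ v : V4, (v : Perm (Fin 4)) ≠ 1 → (φ v : Perm (Fin 4)) ≠ 1 := fun v hv h =>
      hv (congrArg Subtype.val ((map_eq_one_iff φ φ.injective).mp (Subtype.ext h)))
    have h₁ := hne (xiF2 a) (by rw [coe_xiF2_a]; decide)
    have h₂ := hne (xiF2 b) (by rw [coe_xiF2_b]; decide)
    have h₃ : (φ (xiF2 a) : Perm (Fin 4)) ≠ φ (xiF2 b) := fun h => by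
      have h' := congrArg Subtype.val (φ.injective (Subtype.ext h))
      rw [coe_xiF2_a, coe_xiF2_b] at h'
      exact absurd h' (by decide)
    have key : ∀ p q : Perm (Fin 4), (p = 1 ∨ p = swap 0 1 * swap 2 3 ∨
        p = swap 0 2 * swap 1 3 ∨ p = swap 0 3 * swap 1 2) → (q = 1 ∨ q = swap 0 1 * swap 2 3 ∨
        q = swap 0 2 * swap 1 3 ∨ q = swap 0 3 * swap 1 2) → p ≠ 1 → q ≠ 1 → p ≠ q →
        ∃ g : Perm (Fin 4), g * (swap 0 1 * swap 2 3) * g⁻¹ = p ∧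
          g * (swap 0 2 * swap 1 3) * g⁻¹ = q := by
      rintro p q (rfl | rfl | rfl | rfl) (rfl | rfl | rfl | rfl) hp hq hpq <;>
        first | exact absurd rfl hp | exact absurd rfl hq | exact absurd rfl hpq | decide
    obtain ⟨g, hg₁, hg₂⟩ := key _ _ (φ (xiF2 a)).2 (φ (xiF2 b)).2 h₁ h₂ h₃
    refine ⟨QuotientGroup.mk' V4 g, MulEquiv.ext fun v => ?_⟩
    obtain ⟨x, rfl⟩ := xiF2_surjective v
    have e : ((quotientToAutV4 (QuotientGroup.mk' V4 g)).toMonoidHom.comp xiF2) =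
        φ.toMonoidHom.comp xiF2 := by
      refine FreeGroup.ext_hom _ _ fun j => Subtype.ext ?_
      fin_cases j
      · refine (quotientToAutV4_mk g (xiF2 a)).trans ?_
        rw [coe_xiF2_a]
        exact hg₁
      · refine (quotientToAutV4_mk g (xiF2 b)).trans ?_
        rw [coe_xiF2_b]
        exact hg₂
    exact DFunLike.congr_fun e x

end SymmetricGroup


/-! ### The homomorphism to the symmetric group -/

section Xi

/-- The homomorphism `SAut(F₂) → S₄` through which the permutation of the strands factors. -/
noncomputable def xi : SAut →* Equiv.Perm (Fin 4) :=
  braidToSAut.liftOfSurjective braidToSAut_surjective ⟨strandPerm, ker_braidToSAut_le⟩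

theorem xi_braidToSAut (g : B4) : xi (braidToSAut g) = strandPerm g :=
  braidToSAut.liftOfRightInverse_comp_apply _
    (Function.rightInverse_surjInv braidToSAut_surjective) ⟨strandPerm, ker_braidToSAut_le⟩ g

theorem xi_inn (x : F2) : xi (inn x) = xiF2 x := by
  rw [← braidToSAut_braidOfF2, xi_braidToSAut, coe_xiF2]

theorem xi_surjective : Function.Surjective xi := by
  intro s
  have hs : s ∈ Submonoid.closure
      (Set.range fun i : Fin 3 => Equiv.swap i.castSucc i.succ) := by
    rw [Equiv.Perm.mclosure_swap_castSucc_succ]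
    trivial
  have hle : Submonoid.closure (Set.range fun i : Fin 3 => Equiv.swap i.castSucc i.succ) ≤
      strandPerm.range.toSubmonoid := by
    rw [Submonoid.closure_le]
    rintro _ ⟨i, rfl⟩
    refine ⟨σ i, ?_⟩
    rw [strandPerm_σ]
    fin_cases i <;> rfl
  obtain ⟨g, rfl⟩ := hle hs
  exact ⟨braidToSAut g, xi_braidToSAut g⟩

theorem xi_ker : xi.ker = K4 := by
  ext f
  constructor
  · intro hf
    obtain ⟨g, rfl⟩ := braidToSAut_surjective f
    rw [MonoidHom.mem_ker, xi_braidToSAut] at hf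
    exact ⟨g, hf, rfl⟩
  · rintro ⟨g, hg, rfl⟩
    rw [MonoidHom.mem_ker, xi_braidToSAut]
    exact hg

theorem xiF2_apply (f : SAut) (x : F2) :
    xiF2 ((f : MulAut F2) x) = quotientToAutV4 (QuotientGroup.mk' V4 (xi f)) (xiF2 x) := by
  obtain ⟨g, rfl⟩ := braidToSAut_surjective f
  refine Subtype.ext ?_
  rw [quotientToAutV4_mk, xi_braidToSAut, coe_braidToSAut, coe_xiF2_braidAct]

theorem mem_congruenceSubgroupPlus_xiF2 (f : SAut) :
    f ∈ congruenceSubgroupPlus xiF2 ↔ ∀ x, xiF2 ((f : MulAut F2) x) = xiF2 x := Iff.rfl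

theorem congruenceSubgroupPlus_xiF2_eq_ker : congruenceSubgroupPlus xiF2 =
    (quotientToAutV4.comp ((QuotientGroup.mk' V4).comp xi)).ker := by
  ext f
  rw [mem_congruenceSubgroupPlus_xiF2, MonoidHom.mem_ker]
  constructor
  · intro h
    refine MulEquiv.ext fun v => ?_
    obtain ⟨x, rfl⟩ := xiF2_surjective v
    exact (xiF2_apply f x).symm.trans (h x)
  · intro h x
    rw [xiF2_apply]
    exact DFunLike.congr_fun h (xiF2 x)

theorem mem_congruenceSubgroupPlus_xiF2_iff (f : SAut) :
    f ∈ congruenceSubgroupPlus xiF2 ↔ xi f ∈ V4 := by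
  rw [congruenceSubgroupPlus_xiF2_eq_ker, MonoidHom.mem_ker, MonoidHom.comp_apply,
    map_eq_one_iff _ quotientToAutV4_bijective.injective]
  exact QuotientGroup.eq_one_iff (xi f)

theorem congruenceSubgroupPlus_xiF2_eq_closure : congruenceSubgroupPlus xiF2 =
    Subgroup.closure ((K4 : Set SAut) ∪ {inn a, inn b}) := by
  apply le_antisymm
  · intro f hf
    -- an inner automorphism has the same image as `f` in `V₄`, and the quotient lies in `K₄`
    obtain ⟨x, hx⟩ := xiF2_surjective ⟨_, (mem_congruenceSubgroupPlus_xiF2_iff f).mp hf⟩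
    have hK : f * (inn x)⁻¹ ∈ K4 := by
      rw [← xi_ker, MonoidHom.mem_ker, map_mul, map_inv, xi_inn, hx, mul_inv_cancel]
    have hinn : ∀ y, inn y ∈ Subgroup.closure ((K4 : Set SAut) ∪ {inn a, inn b}) := by
      intro y
      induction y using FreeGroup.induction_on with
      | C1 => rw [map_one]; exact one_mem _
      | of j =>
        apply Subgroup.subset_closure
        fin_cases j
        · exact Or.inr (Or.inl rfl)
        · exact Or.inr (Or.inr rfl)
      | inv_of j h => rw [map_inv]; exact inv_mem h
      | mul y z hy hz => rw [map_mul]; exact mul_mem hy hz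
    rw [← inv_mul_cancel_right f (inn x)]
    exact mul_mem (Subgroup.subset_closure (Or.inl hK)) (hinn x)
  · rw [Subgroup.closure_le]
    rintro f (hf | rfl | rfl) <;>
      rw [SetLike.mem_coe, mem_congruenceSubgroupPlus_xiF2_iff]
    · rw [SetLike.mem_coe, ← xi_ker, MonoidHom.mem_ker] at hf
      rw [hf]
      exact one_mem _
    · rw [xi_inn]
      exact (xiF2 a).2
    · rw [xi_inn]
      exact (xiF2 b).2

end Xi

end BraidF2

/-- For the epimorphism `xiF2 : F₂ ≅ Inn(F₂) → V₄`, i.e. the mod-2 abelianization, the group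
`Γ⁺(V₄, ξ)` is the subgroup `⟨K₄, a, b⟩` of `SAut(F₂)`, and it is the kernel of
`SAut(F₂) → S₄ → S₄ / V₄ = S₃ ≅ Aut(V₄)`. -/
theorem proposition2p2 :
    -- `xiF2` is onto, with kernel the elements whose exponent sums are even (mod-2 abelianization)
    Function.Surjective xiF2 ∧
    (∀ x : F2, xiF2 x = 1 ↔ ∀ i, Even (expSum x i)) ∧
    -- the congruence subgroup is principal, normal and of finite index in `SAut(F₂)`
    xiF2.ker.Characteristic ∧
    (congruenceSubgroupPlus xiF2).Normal ∧
    (congruenceSubgroupPlus xiF2).FiniteIndex ∧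
    -- it is generated by `K₄` and the conjugations by `a` and `b`
    congruenceSubgroupPlus xiF2 = Subgroup.closure ((K4 : Set SAut) ∪ {inn a, inn b}) ∧
    -- `S₃ = S₄ / V₄ ≅ Aut(V₄)`
    Nonempty (Equiv.Perm (Fin 4) ⧸ V4 ≃* Equiv.Perm (Fin 3)) ∧
    Function.Bijective quotientToAutV4 ∧
    -- the permutation of the strands descends to a unique `ξ : SAut(F₂) → S₄`
    ∃ ξ : SAut →* Equiv.Perm (Fin 4),
      (∀ g : B4, ξ (braidToSAut g) = strandPerm g) ∧
      (∀ ξ' : SAut →* Equiv.Perm (Fin 4),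
        (∀ g : B4, ξ' (braidToSAut g) = strandPerm g) → ξ' = ξ) ∧
      Function.Surjective ξ ∧
      ξ.ker = K4 ∧
      -- which restricts to `xiF2` on `Inn(F₂)`
      (∀ x : F2, ξ (inn x) = xiF2 x) ∧
      -- the composite `SAut(F₂) → S₄ → S₃ ≅ Aut(V₄)` is the action induced by that on `F₂`
      (∀ (f : SAut) (x : F2),
        xiF2 ((f : MulAut F2) x) = quotientToAutV4 (QuotientGroup.mk' V4 (ξ f)) (xiF2 x)) ∧
      congruenceSubgroupPlus xiF2 =
        (quotientToAutV4.comp ((QuotientGroup.mk' V4).comp ξ)).ker := by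
  refine ⟨xiF2_surjective, xiF2_eq_one_iff, xiF2_ker_characteristic, ?_, ?_,
    congruenceSubgroupPlus_xiF2_eq_closure,
    ⟨(MulEquiv.ofBijective _ permFinThree_bijective).symm⟩, quotientToAutV4_bijective,
    xi, xi_braidToSAut, ?_, xi_surjective, xi_ker, xi_inn, xiF2_apply,
    congruenceSubgroupPlus_xiF2_eq_ker⟩
  · rw [congruenceSubgroupPlus_xiF2_eq_ker]
    exact MonoidHom.normal_ker _
  · rw [congruenceSubgroupPlus_xiF2_eq_ker]
    exact Subgroup.finiteIndex_ker _
  · intro ξ' h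
    refine MonoidHom.ext fun f => ?_
    obtain ⟨g, rfl⟩ := braidToSAut_surjective f
    rw [h, xi_braidToSAut]
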